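/- Let $X$ be a compact metric space and $T:X\to X$ a homeomorphism such that $(X,T)$ is minimal, i.e. $X$ has no proper non-empty closed subset $C$ with $T^nC\subseteq C$ for all $n\in\mathbb Z$. Call $A\subseteq\mathbb Z$ an IP-set if $A$ is infinite and there is a sequence $(n_i)_{i\ge 1}$ of (not necessarily distinct) integers such that $$A=\{n_{i_1}+n_{i_2}+\dots+n_{i_k} : k\ge 1,\ i_1<i_2<\dots<i_k\},$$ and call a subset of $\mathbb Z$ an IP*-set if it intersects every IP-set. Suppose that $(X,T)$ is topologically mildly mixing, i.e. for all non-empty open $U,V\subseteq X$ the set $\{n\in\mathbb Z : U\cap T^{-n}V\neq\emptyset\}$ is an IP*-set. Let $d\ge 1$ be an integer and let $p_1,\dots,p_d$ be integral polynomials (polynomials taking integer values at the integers) such that no $p_i$ is constant and no $p_i-p_j$ with $i\neq j$ is constant. Then for every IP-set $A$ there is a dense $G_\delta$ subset $X_0$ of $X$ such that for every $x\in X_0$ the set $$\{(T^{p_1(n)}x,\dots,T^{p_d(n)}x) : n\in A\}$$ is dense in $X^d$. -/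

import Mathlib

open Set

/-- `FS n`: the set of all finite sums `n_{i₁} + ⋯ + n_{iₖ}` with `k ≥ 1` and distinct indices
`i₁ < ⋯ < iₖ`, for a sequence `n` of (not necessarily distinct) integers. -/
def finiteSums (n : ℕ → ℤ) : Set ℤ :=
  {m | ∃ α : Finset ℕ, α.Nonempty ∧ m = ∑ i ∈ α, n i}

/-- An IP-set of integers: the set of finite sums of a sequence of integers. Repetitions in the
sequence are allowed; only the degenerate finite sets (such as `{0}`, generated by the zero
sequence) are excluded, that is, the sequence has infinitely many non-zero terms. -/
def IsIPSet (A : Set ℤ) : Prop :=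
  A.Infinite ∧ ∃ n : ℕ → ℤ, A = finiteSums n

/-- An IP*-set: a set of integers that intersects every IP-set. -/
def IsIPStarSet (B : Set ℤ) : Prop :=
  ∀ A : Set ℤ, IsIPSet A → (B ∩ A).Nonempty

/-- The system `(X, T)` is minimal: `X` has no proper non-empty closed subset that is invariant
under the `ℤ`-action generated by `T`. -/
def IsMinimalSystem {X : Type*} [TopologicalSpace X] (T : X ≃ₜ X) : Prop :=
  ∀ C : Set X, IsClosed C → C.Nonempty → (∀ n : ℤ, MapsTo (⇑(T ^ n)) C C) → C = univ

/-- `N(U, V) = {n ∈ ℤ : U ∩ T⁻ⁿ V ≠ ∅}`. -/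
def returnTimes {X : Type*} [TopologicalSpace X] (T : X ≃ₜ X) (U V : Set X) : Set ℤ :=
  {n | (U ∩ (⇑(T ^ n)) ⁻¹' V).Nonempty}

/-- Topological mild mixing (for minimal systems): every `N(U, V)`, with `U` and `V` non-empty and
open, is an IP*-set. -/
def IsTopMildlyMixing {X : Type*} [TopologicalSpace X] (T : X ≃ₜ X) : Prop :=
  ∀ U V : Set X, IsOpen U → IsOpen V → U.Nonempty → V.Nonempty → IsIPStarSet (returnTimes T U V)

/-- An integral polynomial, that is, a polynomial taking integer values at the integers, given as
the function `ℤ → ℤ` that it defines (which determines it). -/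
def IsIntegralPolynomial (p : ℤ → ℤ) : Prop :=
  ∃ P : Polynomial ℝ, ∀ n : ℤ, P.eval (n : ℝ) = (p n : ℝ)

/-- The function `p` is constant. -/
def IsConstantFun (p : ℤ → ℤ) : Prop :=
  ∃ c : ℤ, ∀ n : ℤ, p n = c

/-! By Baire category it suffices to find, for non-empty open `U` and `V i`, one `n ∈ A` and `x ∈ U`
with `T ^ p i n` taking `x` into each `V i`. Subtracting constants makes the polynomials distinct,
non-zero and zero at `0`; then induct on a PET weight.

By minimality a finite `F` exists such that every point enters `U` under some `T ^ (-c)`, `c ∈ F`.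
So seek `z`, `n` and shifts `k c` with `T ^ (-c + P(n + k c)) z ∈ V P` for all `P` and `c`;
whichever `c` sends `z` into `U` then solves the problem at time `n + k c`. With `z = T ^ (-p(n)) x`
and `p` of least degree, the polynomials become `P(n + k c) - P(k c) - p(n)`, a family of smaller
weight (`petStep_lt`).

Pairs `(P, c)` with equal increments impose conditions on the same point. Suitable `k c` separate
the non-linear increments; linear ones ignore the shift, and there mild mixing makes the conditions
compatible (`exists_targetSet_nonempty`). Hindman's theorem lets one `k c` meet all these demands.
-/

open Polynomial

/-! ### Zero-sum-free sequences, IP-sets and Hindman's theorem -/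

/-- A sequence of integers none of whose finite sums over non-empty index sets vanishes. -/
def ZeroSumFree (a : ℕ → ℤ) : Prop := (0 : ℤ) ∉ finiteSums a

theorem sum_mem_finiteSums (a : ℕ → ℤ) {s : Finset ℕ} (hs : s.Nonempty) :
    ∑ i ∈ s, a i ∈ finiteSums a := ⟨s, hs, rfl⟩

theorem finiteSums_infinite_of_zeroSumFree {a : ℕ → ℤ} (ha : ZeroSumFree a) :
    (finiteSums a).Infinite := by
  intro hfin
  have hmaps : MapsTo (fun n : ℕ => ∑ i ∈ Finset.range (n + 1), a i) univ (finiteSums a) :=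
    fun n _ => sum_mem_finiteSums a (by simp)
  obtain ⟨m, -, n, -, hmn, h⟩ := infinite_univ.exists_lt_map_eq_of_mapsTo hmaps hfin
  apply ha
  refine ⟨Finset.Ico (m + 1) (n + 1), by simp [hmn], ?_⟩
  have := Finset.sum_range_add_sum_Ico a (show m + 1 ≤ n + 1 by omega)
  linarith

theorem ZeroSumFree.isIPSet {a : ℕ → ℤ} (ha : ZeroSumFree a) : IsIPSet (finiteSums a) :=
  ⟨finiteSums_infinite_of_zeroSumFree ha, a, rfl⟩

theorem ZeroSumFree.const_mul {a : ℕ → ℤ} (ha : ZeroSumFree a) {c : ℤ} (hc : c ≠ 0) :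
    ZeroSumFree fun i => c * a i := by
  rintro ⟨s, hs, h⟩
  rw [← Finset.mul_sum] at h
  exact ha ⟨s, hs, ((mul_eq_zero.1 h.symm).resolve_left hc).symm⟩

theorem finiteSums_comp_add_subset (a : ℕ → ℤ) (M : ℕ) {n : ℤ}
    (hn : n ∈ finiteSums fun i => a (i + M)) :
    ∃ t : Finset ℕ, t.Nonempty ∧ (∀ i ∈ t, M ≤ i) ∧ n = ∑ i ∈ t, a i := by
  obtain ⟨s, hs, rfl⟩ := hn
  refine ⟨s.map (addRightEmbedding M), by simpa using hs, ?_, by simp⟩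
  simp

theorem ZeroSumFree.comp_add {a : ℕ → ℤ} (ha : ZeroSumFree a) (M : ℕ) :
    ZeroSumFree fun i => a (i + M) := by
  intro h
  obtain ⟨t, ht, -, h0⟩ := finiteSums_comp_add_subset a M h
  exact ha ⟨t, ht, h0⟩

theorem hindman_FS_eq_finiteSums (a : Stream' ℤ) : Hindman.FS a = finiteSums a.get := by
  apply Subset.antisymm
  · intro m hm
    induction hm with
    | head' a => exact ⟨{0}, by simp, by simp [Stream'.head]⟩
    | tail' a m _ ih =>
      obtain ⟨s, hs, rfl⟩ := ih
      exact ⟨s.map (addRightEmbedding 1), by simpa using hs, by simp [Stream'.get_tail]⟩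
    | cons' a m _ ih =>
      obtain ⟨s, hs, rfl⟩ := ih
      refine ⟨insert 0 (s.map (addRightEmbedding 1)), by simp, ?_⟩
      rw [Finset.sum_insert (by simp)]
      simp [Stream'.get_tail, Stream'.head]
  · rintro _ ⟨s, hs, rfl⟩
    exact Hindman.FS.finsetSum a s hs

/-- Sets meeting the finite sums of every zero-sum-free sequence. -/
def MeetsFiniteSums (B : Set ℤ) : Prop :=
  ∀ a : ℕ → ℤ, ZeroSumFree a → ∃ n ∈ finiteSums a, n ∈ B

/-- Colour the finite sums by membership in `B`. Hindman's theorem puts all finite sums of some `b`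
in one colour, and `b` inherits zero-sum-freeness; the colour cannot be the complement of `B`, and
`C` meets these sums. -/
theorem MeetsFiniteSums.inter {B C : Set ℤ} (hB : MeetsFiniteSums B) (hC : MeetsFiniteSums C) :
    MeetsFiniteSums (B ∩ C) := by
  intro a ha
  have hcov : Hindman.FS (show Stream' ℤ from a) ⊆
      ⋃₀ {finiteSums a ∩ B, finiteSums a \ B} := by
    rw [hindman_FS_eq_finiteSums]
    intro m hm
    have hm' : m ∈ finiteSums a := hm
    by_cases h : m ∈ B
    · exact ⟨_, Or.inl rfl, hm', h⟩
    · exact ⟨_, Or.inr rfl, hm', h⟩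
  obtain ⟨c, hc, b, hb⟩ := Hindman.FS_partition_regular _ _ (by simp) hcov
  rw [hindman_FS_eq_finiteSums] at hb
  have hca : c ⊆ finiteSums a := by
    rcases hc with rfl | rfl
    · exact inter_subset_left
    · exact sdiff_subset
  have hb0 : ZeroSumFree b.get := fun h => ha (hca (hb h))
  rcases hc with rfl | rfl
  · obtain ⟨n, hn, hnC⟩ := hC _ hb0
    exact ⟨n, (hb hn).1, (hb hn).2, hnC⟩
  · obtain ⟨n, hn, hnB⟩ := hB _ hb0
    exact absurd hnB (hb hn).2

theorem MeetsFiniteSums.biInter {ι : Type*} (s : Finset ι) {B : ι → Set ℤ}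
    (hB : ∀ i ∈ s, MeetsFiniteSums (B i)) : MeetsFiniteSums {n | ∀ i ∈ s, n ∈ B i} := by
  classical
  induction s using Finset.induction_on with
  | empty => exact fun a _ => ⟨_, sum_mem_finiteSums a (Finset.singleton_nonempty 0), by simp⟩
  | insert i s _ ih =>
    have := (hB i (by simp)).inter (ih fun j hj => hB j (by simp [hj]))
    convert this using 1
    ext n
    simp

theorem meetsFiniteSums_compl_of_finite {F : Set ℤ} (hF : F.Finite) : MeetsFiniteSums Fᶜ := by
  intro a ha
  exact (finiteSums_infinite_of_zeroSumFree ha).exists_notMem_finite hF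

/-- Otherwise every finite sum is one of finitely many head sums plus a bounded integer. -/
theorem exists_large_tail_sum {a : ℕ → ℤ} (ha : (finiteSums a).Infinite) (M : ℕ) (L : ℤ) :
    ∃ t : Finset ℕ, t.Nonempty ∧ (∀ i ∈ t, M ≤ i) ∧ L < |∑ i ∈ t, a i| := by
  by_contra! hcon
  apply ha
  have hL : (Icc (-|L|) |L|).Finite := finite_Icc _ _
  refine ((((Finset.range M).powerset.finite_toSet).image fun s => ∑ i ∈ s, a i).add hL).subset ?_
  rintro _ ⟨s, hs, rfl⟩
  rw [← Finset.sum_filter_add_sum_filter_not s (· < M)]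
  refine add_mem_add ⟨_, ?_, rfl⟩ ?_
  · simp only [Finset.coe_powerset, mem_preimage, mem_powerset_iff]
    intro i
    simp
  · rcases (s.filter fun i => ¬ i < M).eq_empty_or_nonempty with h | h
    · rw [h]; simp
    · have := hcon _ h (by simp)
      exact abs_le.1 (this.trans (le_abs_self L))

/-- Every IP-set contains the finite sums of a zero-sum-free sequence. -/
theorem exists_zeroSumFree_subset {A : Set ℤ} (hA : IsIPSet A) :
    ∃ b : ℕ → ℤ, ZeroSumFree b ∧ finiteSums b ⊆ A := by
  classical
  obtain ⟨hinf, a, rfl⟩ := hA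
  choose t htne htM htL using exists_large_tail_sum hinf
  let N : Finset ℕ → ℕ := fun u => u.sup id + 1
  -- `u n` collects the indices used so far. The next block lies beyond them, and its sum exceeds
  -- their total absolute value.
  let u : ℕ → Finset ℕ := fun n => Nat.rec ∅ (fun _ v => v ∪ t (N v) (∑ i ∈ v, |a i|)) n
  have hu : ∀ n, u (n + 1) = u n ∪ t (N (u n)) (∑ i ∈ u n, |a i|) := fun _ => rfl
  let s : ℕ → Finset ℕ := fun n => t (N (u n)) (∑ i ∈ u n, |a i|)
  have hmono : Monotone u := monotone_nat_of_le_succ fun n => by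
    rw [hu]; exact Finset.subset_union_left
  have hsu : ∀ n, s n ⊆ u (n + 1) := fun n => by rw [hu]; exact Finset.subset_union_right
  have hdisj0 : ∀ n, Disjoint (u n) (s n) := by
    intro n
    rw [Finset.disjoint_left]
    intro i hi hi'
    have h1 : i ≤ (u n).sup id := Finset.le_sup (f := id) hi
    have h2 : (u n).sup id + 1 ≤ i := htM _ _ i hi'
    omega
  have hdisj : Pairwise fun m n => Disjoint (s m) (s n) := by
    have key : ∀ m n, m < n → Disjoint (s m) (s n) := fun m n hmn =>
      (hdisj0 n).mono_left ((hsu m).trans (hmono hmn))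
    intro m n hmn
    rcases lt_or_gt_of_ne hmn with h | h
    · exact key m n h
    · exact (key n m h).symm
  have hsum : ∀ v : Finset ℕ, ∑ n ∈ v, ∑ i ∈ s n, a i = ∑ i ∈ v.biUnion s, a i := fun v =>
    (Finset.sum_biUnion fun m _ n _ hmn => hdisj hmn).symm
  refine ⟨fun n => ∑ i ∈ s n, a i, ?_, ?_⟩
  · rintro ⟨v, hv, h0⟩
    -- The last block dominates all the others, so no cancellation to `0` is possible.
    set m := v.max' hv with hm
    have hmv : m ∈ v := v.max'_mem hv
    rw [← Finset.add_sum_erase v _ hmv] at h0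
    have hlt : ∑ i ∈ u m, |a i| < |∑ i ∈ s m, a i| := htL _ _
    have hle : |∑ n ∈ v.erase m, ∑ i ∈ s n, a i| ≤ ∑ i ∈ u m, |a i| := by
      rw [hsum]
      refine (Finset.abs_sum_le_sum_abs _ _).trans ?_
      refine Finset.sum_le_sum_of_subset_of_nonneg ?_ fun _ _ _ => abs_nonneg _
      intro i hi
      obtain ⟨n, hn, hi⟩ := Finset.mem_biUnion.1 hi
      have hnm : n < m := Finset.lt_max'_of_mem_erase_max' v hv hn
      exact hmono hnm (hsu n hi)
    have : ∑ i ∈ s m, a i = - ∑ n ∈ v.erase m, ∑ i ∈ s n, a i := by linarith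
    rw [this, abs_neg] at hlt
    exact absurd hle (not_le.2 hlt)
  · rintro _ ⟨v, hv, rfl⟩
    refine ⟨v.biUnion s, ?_, hsum v⟩
    obtain ⟨n, hn⟩ := hv
    obtain ⟨i, hi⟩ := htne (N (u n)) (∑ i ∈ u n, |a i|)
    exact ⟨i, Finset.mem_biUnion.2 ⟨n, hn, hi⟩⟩

/-! ### Increments of integer-valued polynomials -/

/-- The increment of `P` at `k`, normalised to vanish at `0`. -/
noncomputable def shiftPoly (P : ℝ[X]) (k : ℝ) : ℝ[X] := P.comp (X + C k) - C (P.eval k)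

theorem shiftPoly_eval (P : ℝ[X]) (k x : ℝ) :
    (shiftPoly P k).eval x = P.eval (x + k) - P.eval k := by
  simp [shiftPoly]

theorem natDegree_shiftPoly (P : ℝ[X]) (k : ℝ) : (shiftPoly P k).natDegree = P.natDegree := by
  simp [shiftPoly, natDegree_comp]

theorem leadingCoeff_shiftPoly {P : ℝ[X]} (hP : 0 < P.natDegree) (k : ℝ) :
    (shiftPoly P k).leadingCoeff = P.leadingCoeff := by
  rw [leadingCoeff, natDegree_shiftPoly]
  have h : (P.comp (X + C k)).leadingCoeff = P.leadingCoeff := by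
    rw [leadingCoeff_comp (by simp)]; simp
  rw [leadingCoeff, natDegree_comp] at h
  simp only [natDegree_X_add_C, mul_one] at h
  rw [shiftPoly, coeff_sub, h, coeff_C_of_ne_zero hP.ne', sub_zero]

theorem natDegree_pos_of_eval_zero {P : ℝ[X]} (h0 : P.eval 0 = 0) (hP : P ≠ 0) :
    0 < P.natDegree := by
  by_contra h
  have hc := eq_C_of_natDegree_eq_zero (Nat.eq_zero_of_not_pos h)
  rw [hc] at h0
  apply hP
  rw [hc]
  simpa using h0

/-- Equal increments at `k ≠ l` give the derivative the period `k - l`, so it is constant. -/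
theorem shiftPoly_injective {P : ℝ[X]} (hP : 1 < P.natDegree) :
    Function.Injective (shiftPoly P) := by
  intro k l h
  by_contra hkl
  have hper : ∀ x, P.derivative.eval (x + k) = P.derivative.eval (x + l) := by
    intro x
    have := congrArg (fun Q : ℝ[X] => Q.derivative.eval x) h
    simpa [shiftPoly, derivative_comp] using this
  have hm : ∀ m : ℕ, P.derivative.eval (m * (k - l)) = P.derivative.eval 0 := by
    intro m
    induction m with
    | zero => simp
    | succ m ih =>
      have := hper (m * (k - l) - l)
      rw [show (m : ℝ) * (k - l) - l + k = ((m + 1 : ℕ) : ℝ) * (k - l) by push_cast; ring,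
        sub_add_cancel] at this
      rw [this, ih]
  have hinj : Function.Injective fun m : ℕ => (m : ℝ) * (k - l) := fun m n hmn => by
    have := mul_right_cancel₀ (sub_ne_zero.2 hkl) hmn
    exact_mod_cast this
  have hconst : P.derivative = C (P.derivative.eval 0) := by
    refine eq_of_infinite_eval_eq _ _ ((infinite_range_of_injective hinj).mono ?_)
    rintro _ ⟨m, rfl⟩
    simpa using hm m
  have hdeg := natDegree_derivative P
  rw [hconst, natDegree_C] at hdeg
  omega

theorem shiftPoly_of_natDegree_le_one {P : ℝ[X]} (hP : P.natDegree ≤ 1) (h0 : P.eval 0 = 0)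
    (k : ℝ) : shiftPoly P k = P := by
  obtain ⟨a, b, rfl⟩ := exists_eq_X_add_C_of_natDegree_le_one hP
  have : b = 0 := by simpa using h0
  subst this
  simp [shiftPoly]
  ring

theorem shiftPoly_right_injective {P Q : ℝ[X]} {k : ℝ} (hP : P.eval 0 = 0) (hQ : Q.eval 0 = 0)
    (h : shiftPoly P k = shiftPoly Q k) : P = Q := by
  have hv : ∀ x, P.eval (x + k) - P.eval k = Q.eval (x + k) - Q.eval k := fun x => by
    rw [← shiftPoly_eval, h, shiftPoly_eval]
  have h0 := hv (-k)
  simp only [neg_add_cancel, hP, hQ] at h0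
  refine funext fun x => ?_
  have := hv (x - k)
  simp only [sub_add_cancel] at this
  linarith

/-- Integer-valued polynomials without constant term, other than `0`. -/
structure IsNormalized (P : ℝ[X]) : Prop where
  integral : ∀ n : ℤ, ∃ m : ℤ, P.eval (n : ℝ) = m
  eval_zero : P.eval 0 = 0
  ne_zero : P ≠ 0

theorem IsNormalized.natDegree_pos {P : ℝ[X]} (hP : IsNormalized P) : 0 < P.natDegree :=
  natDegree_pos_of_eval_zero hP.eval_zero hP.ne_zero

/-- The value of an integer-valued polynomial at an integer, as an integer. -/
noncomputable def intVal (P : ℝ[X]) (n : ℤ) : ℤ := ⌊P.eval (n : ℝ)⌋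

theorem IsNormalized.coe_intVal {P : ℝ[X]} (hP : IsNormalized P) (n : ℤ) :
    (intVal P n : ℝ) = P.eval (n : ℝ) := by
  obtain ⟨m, hm⟩ := hP.integral n
  rw [intVal, hm, Int.floor_intCast]

theorem intVal_shiftPoly_sub {P p : ℝ[X]} (hP : IsNormalized P) (hp : IsNormalized p) (k n : ℤ) :
    intVal (shiftPoly P k - p) n = intVal P (n + k) - intVal P k - intVal p n := by
  have : (shiftPoly P k - p).eval (n : ℝ) =
      ((intVal P (n + k) - intVal P k - intVal p n : ℤ) : ℝ) := by
    push_cast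
    rw [hP.coe_intVal, hP.coe_intVal, hp.coe_intVal, eval_sub, shiftPoly_eval]
    push_cast
    rfl
  rw [intVal, this, Int.floor_intCast]

theorem IsNormalized.shiftPoly_sub {P p : ℝ[X]} (hP : IsNormalized P) (hp : IsNormalized p)
    (k : ℤ) (h : shiftPoly P k - p ≠ 0) : IsNormalized (shiftPoly P k - p) where
  integral n := by
    refine ⟨intVal P (n + k) - intVal P k - intVal p n, ?_⟩
    push_cast
    rw [hP.coe_intVal, hP.coe_intVal, hp.coe_intVal, eval_sub, shiftPoly_eval]
    push_cast
    rfl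
  eval_zero := by rw [eval_sub, shiftPoly_eval, hp.eval_zero]; simp
  ne_zero := h

theorem IsNormalized.exists_intVal_eq_mul {P : ℝ[X]} (hP : IsNormalized P)
    (hdeg : P.natDegree ≤ 1) : ∃ c : ℤ, c ≠ 0 ∧ ∀ n, intVal P n = c * n := by
  obtain ⟨a, b, hab⟩ := exists_eq_X_add_C_of_natDegree_le_one hdeg
  have hb : b = 0 := by simpa [hab] using hP.eval_zero
  obtain ⟨c, hc⟩ := hP.integral 1
  have ha : a = c := by simpa [hab, hb] using hc
  refine ⟨c, ?_, fun n => ?_⟩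
  · rintro rfl
    apply hP.ne_zero
    rw [hab, ha, hb]
    simp
  · have h : P.eval (n : ℝ) = c * n := by rw [hab, hb, ha]; simp
    exact_mod_cast (hP.coe_intVal n).trans h

/-! ### The PET weight and its descent -/

/-- The leading coefficients of the members of degree `D`. -/
noncomputable def leadingCoeffs (S : Finset ℝ[X]) (D : ℕ) : Finset ℝ :=
  (S.filter fun P => P.natDegree = D).image leadingCoeff

/-- The PET weight: the number of leading coefficients in each degree. -/
noncomputable def petWeight (S : Finset ℝ[X]) : ℕ →₀ ℕ :=
  Finsupp.onFinset (S.image natDegree) (fun D => (leadingCoeffs S D).card) fun D hD => by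
    obtain ⟨c, hc⟩ := Finset.card_pos.1 (Nat.pos_of_ne_zero hD)
    obtain ⟨P, hP, -⟩ := Finset.mem_image.1 hc
    rw [Finset.mem_filter] at hP
    exact Finset.mem_image.2 ⟨P, hP⟩

/-- Comparison of weights at the largest degree where they differ. -/
def PetLT (S' S : Finset ℝ[X]) : Prop :=
  Finsupp.Lex (· > ·) (· < ·) (petWeight S') (petWeight S)

theorem petLT_wellFounded : WellFounded PetLT :=
  InvImage.wf petWeight <| Finsupp.Lex.wellFounded' (fun _ => Nat.not_lt_zero _)
    Nat.lt_wfRel.wf Nat.lt_wfRel.wf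

theorem mem_leadingCoeffs {S : Finset ℝ[X]} {D : ℕ} {c : ℝ} :
    c ∈ leadingCoeffs S D ↔ ∃ P ∈ S, P.natDegree = D ∧ P.leadingCoeff = c := by
  simp [leadingCoeffs, and_assoc]

open Classical in
/-- The family of increments of the members of `S`, taken relative to `p`. -/
noncomputable def petStep (S : Finset ℝ[X]) (p : ℝ[X]) (F : Finset ℤ) (k : ℤ → ℤ) :
    Finset ℝ[X] :=
  ((S ×ˢ F).image fun x => shiftPoly x.1 (k x.2) - p).erase 0

theorem mem_petStep {S : Finset ℝ[X]} {p : ℝ[X]} {F : Finset ℤ} {k : ℤ → ℤ} {R : ℝ[X]} :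
    R ∈ petStep S p F k ↔ R ≠ 0 ∧ ∃ P ∈ S, ∃ c ∈ F, shiftPoly P (k c) - p = R := by
  simp [petStep, and_assoc]

theorem petStep_isNormalized {S : Finset ℝ[X]} (hS : ∀ P ∈ S, IsNormalized P) {p : ℝ[X]}
    (hp : p ∈ S) (F : Finset ℤ) (k : ℤ → ℤ) : ∀ R ∈ petStep S p F k, IsNormalized R := by
  intro R hR
  obtain ⟨h0, P, hP, c, -, rfl⟩ := mem_petStep.1 hR
  exact (hS P hP).shiftPoly_sub (hS p hp) _ h0

/-- Above the degree of `p`, leading coefficients are unchanged. At that degree they are translated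
by that of `p`, whose own class drops in degree. Lower degrees may grow, but count for less. -/
theorem petStep_lt {S : Finset ℝ[X]} (hS : ∀ P ∈ S, IsNormalized P) {p : ℝ[X]} (hp : p ∈ S)
    (hmin : ∀ P ∈ S, p.natDegree ≤ P.natDegree) {F : Finset ℤ} (hF : F.Nonempty) (k : ℤ → ℤ) :
    PetLT (petStep S p F k) S := by
  have hpos := (hS p hp).natDegree_pos
  have hbig : ∀ P ∈ S, ∀ c, p.natDegree < P.natDegree →
      (shiftPoly P (k c) - p).natDegree = P.natDegree ∧
      (shiftPoly P (k c) - p).leadingCoeff = P.leadingCoeff := by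
    intro P hP c hlt
    rw [← natDegree_shiftPoly P (k c)] at hlt
    refine ⟨(natDegree_sub_eq_left_of_natDegree_lt hlt).trans (natDegree_shiftPoly _ _), ?_⟩
    rw [leadingCoeff_sub_of_degree_lt (degree_lt_degree hlt),
      leadingCoeff_shiftPoly (hS P hP).natDegree_pos]
  have hle : ∀ P ∈ S, ∀ c, P.natDegree = p.natDegree →
      (shiftPoly P (k c) - p).natDegree ≤ p.natDegree := by
    intro P hP c h
    refine (natDegree_sub_le _ _).trans ?_
    rw [natDegree_shiftPoly, h, max_self]
  have hcoeff : ∀ P ∈ S, ∀ c, P.natDegree = p.natDegree →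
      (shiftPoly P (k c) - p).coeff p.natDegree = P.leadingCoeff - p.leadingCoeff := by
    intro P hP c h
    rw [coeff_sub, ← leadingCoeff_shiftPoly (hS P hP).natDegree_pos (k c), leadingCoeff,
      leadingCoeff, natDegree_shiftPoly, h]
  refine ⟨p.natDegree, fun E hE => ?_, ?_⟩
  · change (leadingCoeffs _ E).card = (leadingCoeffs _ E).card
    congr 1
    ext a
    rw [mem_leadingCoeffs, mem_leadingCoeffs]
    constructor
    · rintro ⟨R, hR, rfl, rfl⟩
      obtain ⟨-, P, hP, c, -, rfl⟩ := mem_petStep.1 hR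
      rcases (hmin P hP).lt_or_eq with h | h
      · exact ⟨P, hP, (hbig P hP c h).1.symm, (hbig P hP c h).2.symm⟩
      · exact absurd (hle P hP c h.symm) (not_le.2 hE)
    · rintro ⟨P, hP, rfl, rfl⟩
      -- A non-empty `F` is needed for the higher leading coefficients to survive.
      obtain ⟨c, hc⟩ := hF
      obtain ⟨h1, h2⟩ := hbig P hP c hE
      refine ⟨_, mem_petStep.2 ⟨?_, P, hP, c, hc, rfl⟩, h1, h2⟩
      rintro h
      rw [h, natDegree_zero] at h1
      exact (hS P hP).natDegree_pos.ne h1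
  · change (leadingCoeffs _ _).card < (leadingCoeffs _ _).card
    have hpm : p.leadingCoeff ∈ leadingCoeffs S p.natDegree :=
      mem_leadingCoeffs.2 ⟨p, hp, rfl, rfl⟩
    have hsub : leadingCoeffs (petStep S p F k) p.natDegree ⊆
        ((leadingCoeffs S p.natDegree).erase p.leadingCoeff).image (· - p.leadingCoeff) := by
      intro a ha
      obtain ⟨R, hR, hRd, rfl⟩ := mem_leadingCoeffs.1 ha
      obtain ⟨hR0, P, hP, c, -, rfl⟩ := mem_petStep.1 hR
      rcases (hmin P hP).lt_or_eq with h | h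
      · exact absurd hRd ((hbig P hP c h).1.trans_ne h.ne')
      · have hlc := hcoeff P hP c h.symm
        rw [← hRd] at hlc
        change leadingCoeff _ = _ at hlc
        refine Finset.mem_image.2 ⟨P.leadingCoeff, Finset.mem_erase.2 ⟨fun he => ?_,
          mem_leadingCoeffs.2 ⟨P, hP, h.symm, rfl⟩⟩, hlc.symm⟩
        rw [he, sub_self, leadingCoeff_eq_zero] at hlc
        exact hR0 hlc
    calc _ ≤ _ := Finset.card_le_card hsub
      _ ≤ _ := Finset.card_image_le
      _ < _ := Finset.card_erase_lt_of_mem hpm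

/-! ### Consequences of minimality and mild mixing -/

theorem zpow_add_apply {X : Type*} [TopologicalSpace X] (T : X ≃ₜ X) (m n : ℤ) (x : X) :
    (T ^ (m + n)) x = (T ^ m) ((T ^ n) x) := by
  rw [zpow_add]; rfl

/-- The points never entering `U` form a closed invariant set missing `U`, hence empty; compactness
does the rest. -/
theorem IsMinimalSystem.exists_finset_cover {X : Type*} [TopologicalSpace X] [CompactSpace X]
    {T : X ≃ₜ X} (hT : IsMinimalSystem T) {U : Set X} (hU : IsOpen U) (hne : U.Nonempty) :
    ∃ F : Finset ℤ, ∀ x, ∃ c ∈ F, (T ^ (-c)) x ∈ U := by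
  have hopen : ∀ c : ℤ, IsOpen ((T ^ (-c)) ⁻¹' U) := fun c => hU.preimage (T ^ (-c)).continuous
  have hcov : univ ⊆ ⋃ c : ℤ, (T ^ (-c)) ⁻¹' U := by
    by_contra hcon
    have hC : ((⋃ c : ℤ, (T ^ (-c)) ⁻¹' U)ᶜ).Nonempty := by
      rwa [nonempty_compl, Ne, ← univ_subset_iff]
    have huniv := hT _ (isOpen_iUnion hopen).isClosed_compl hC fun n x hx hx' => by
      obtain ⟨c, hc⟩ := mem_iUnion.1 hx'
      rw [mem_preimage, ← zpow_add_apply] at hc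
      refine hx (mem_iUnion.2 ⟨c - n, ?_⟩)
      rwa [mem_preimage, neg_sub, sub_eq_neg_add, add_comm, add_comm n]
    obtain ⟨x, hx⟩ := hne
    have hx' := huniv.symm ▸ mem_univ x
    exact hx' (mem_iUnion.2 ⟨0, by simpa using hx⟩)
  obtain ⟨F, hF⟩ := isCompact_univ.elim_finite_subcover _ hopen hcov
  refine ⟨F, fun x => ?_⟩
  simpa using hF (mem_univ x)

theorem IsTopMildlyMixing.meetsFiniteSums {X : Type*} [TopologicalSpace X] {T : X ≃ₜ X}
    (hT : IsTopMildlyMixing T) {P : ℝ[X]} (hP : IsNormalized P) (hdeg : P.natDegree ≤ 1)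
    {W V : Set X} (hW : IsOpen W) (hV : IsOpen V) (hWne : W.Nonempty) (hVne : V.Nonempty)
    (j : ℤ) :
    MeetsFiniteSums {n | (W ∩ (T ^ (j + intVal P n)) ⁻¹' V).Nonempty} := by
  intro a ha
  obtain ⟨c, hc, hval⟩ := hP.exists_intVal_eq_mul hdeg
  obtain ⟨_, ⟨x, hxW, hxV⟩, s, hs, rfl⟩ := hT W ((T ^ j) ⁻¹' V) hW
    (hV.preimage (T ^ j).continuous) hWne (hVne.preimage (T ^ j).surjective)
    _ (ha.const_mul hc).isIPSet
  refine ⟨_, sum_mem_finiteSums a hs, x, hxW, ?_⟩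
  rw [mem_preimage, mem_preimage, ← zpow_add_apply, ← Finset.mul_sum] at hxV
  rwa [mem_preimage, hval]

/-! ### Joint transitivity by PET induction -/

/-- For every `a`, some finite sum of `a` satisfies prescribed transitivity conditions along all
the members of `S` simultaneously. -/
def JointlyTransitive {X : Type*} [TopologicalSpace X] (T : X ≃ₜ X) (S : Finset ℝ[X]) : Prop :=
  ∀ a : ℕ → ℤ, ZeroSumFree a → ∀ U : Set X, IsOpen U → U.Nonempty →
    ∀ V : ℝ[X] → Set X, (∀ P, IsOpen (V P)) → (∀ P, (V P).Nonempty) →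
      ∃ n ∈ finiteSums a, ∃ x ∈ U, ∀ P ∈ S, (T ^ intVal P n) x ∈ V P

/-- The points that satisfy the conditions attached to all the pairs `(P, c)` whose increment
is `R`. -/
def targetSet {X : Type*} [TopologicalSpace X] (T : X ≃ₜ X) (S : Finset ℝ[X]) (F : Finset ℤ)
    (k : ℤ → ℤ) (V : ℝ[X] → Set X) (R : ℝ[X]) : Set X :=
  {y | ∀ P ∈ S, ∀ c ∈ F, shiftPoly P (k c) = R → (T ^ (-c + intVal P (k c))) y ∈ V P}

theorem isOpen_targetSet {X : Type*} [TopologicalSpace X] (T : X ≃ₜ X) (S : Finset ℝ[X])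
    (F : Finset ℤ) (k : ℤ → ℤ) {V : ℝ[X] → Set X} (hV : ∀ P, IsOpen (V P)) (R : ℝ[X]) :
    IsOpen (targetSet T S F k V R) := by
  simp only [targetSet, ofPred_forall]
  exact isOpen_biInter_finset fun P _ => isOpen_biInter_finset fun c _ =>
    isOpen_iInter_of_finite fun _ => (hV P).preimage (T ^ (-c + intVal P (k c))).continuous

theorem IsTopMildlyMixing.exists_targetSet_nonempty {X : Type*} [TopologicalSpace X] [Nonempty X]
    {T : X ≃ₜ X} (hT : IsTopMildlyMixing T) {S : Finset ℝ[X]} (hS : ∀ P ∈ S, IsNormalized P)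
    {a : ℕ → ℤ} (ha : ZeroSumFree a) {V : ℝ[X] → Set X} (hV : ∀ P, IsOpen (V P))
    (hVne : ∀ P, (V P).Nonempty) (F : Finset ℤ) :
    ∃ k : ℤ → ℤ, (∀ c ∈ F, k c ∈ finiteSums a) ∧ ∀ R, (targetSet T S F k V R).Nonempty := by
  classical
  induction F using Finset.induction_on with
  | empty => exact ⟨0, by simp, fun R => ⟨Classical.arbitrary X, by simp [targetSet]⟩⟩
  | insert c F hc ih =>
    obtain ⟨k, hk, hW⟩ := ih
    -- Non-linear `P`: the new increment avoids all earlier ones. Linear `P`: the new condition is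
    -- compatible with the earlier ones.
    let B : ℝ[X] → Set ℤ := fun P =>
      {n | 1 < P.natDegree → ∀ Q ∈ S, ∀ e ∈ F, shiftPoly P n ≠ shiftPoly Q (k e)} ∩
      {n | P.natDegree ≤ 1 →
        (targetSet T S F k V P ∩ (T ^ (-c + intVal P n)) ⁻¹' V P).Nonempty}
    have hB : ∀ P ∈ S, MeetsFiniteSums (B P) := by
      intro P hP
      refine MeetsFiniteSums.inter ?_ ?_
      · by_cases hdeg : 1 < P.natDegree
        · have hfin : {n : ℤ | ∃ Q ∈ S, ∃ e ∈ F, shiftPoly P n = shiftPoly Q (k e)}.Finite := by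
            have hinj : Function.Injective fun n : ℤ => shiftPoly P n :=
              (shiftPoly_injective hdeg).comp Int.cast_injective
            refine (((S ×ˢ F).finite_toSet.image fun x => shiftPoly x.1 (k x.2)).preimage
              hinj.injOn).subset ?_
            rintro n ⟨Q, hQ, e, he, h⟩
            exact ⟨(Q, e), by simp [hQ, he], h.symm⟩
          convert meetsFiniteSums_compl_of_finite hfin using 1
          ext n
          simp [hdeg]
        · intro b _
          exact ⟨_, sum_mem_finiteSums b (Finset.singleton_nonempty 0), fun h => absurd h hdeg⟩
      · by_cases hdeg : P.natDegree ≤ 1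
        · simpa [hdeg] using hT.meetsFiniteSums (hS P hP) hdeg (isOpen_targetSet T S F k hV P)
            (hV P) (hW P) (hVne P) (-c)
        · intro b _
          exact ⟨_, sum_mem_finiteSums b (Finset.singleton_nonempty 0), fun h => absurd h hdeg⟩
    obtain ⟨m, hm, hmB⟩ := MeetsFiniteSums.biInter S hB a ha
    have hkc : ∀ e ∈ F, Function.update k c m e = k e := fun e he =>
      Function.update_of_ne (ne_of_mem_of_not_mem he hc) _ _
    refine ⟨Function.update k c m, ?_, fun R => ?_⟩
    · intro e he
      rcases Finset.mem_insert.1 he with rfl | he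
      · simpa using hm
      · rw [hkc e he]; exact hk e he
    · suffices h : ∃ y ∈ targetSet T S F k V R, ∀ P ∈ S, shiftPoly P m = R →
          (T ^ (-c + intVal P m)) y ∈ V P by
        obtain ⟨y, hy, hy'⟩ := h
        refine ⟨y, fun P hP e he hR => ?_⟩
        rcases Finset.mem_insert.1 he with rfl | he
        · rw [Function.update_self] at hR ⊢
          exact hy' P hP hR
        · rw [hkc e he] at hR ⊢
          exact hy P hP e he hR
      by_cases hex : ∃ P ∈ S, shiftPoly P m = R
      · obtain ⟨P, hP, rfl⟩ := hex
        -- Each `R` receives at most one new condition.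
        have huniq : ∀ Q ∈ S, shiftPoly Q m = shiftPoly P m → Q = P := fun Q hQ h =>
          shiftPoly_right_injective (hS Q hQ).eval_zero (hS P hP).eval_zero h
        by_cases hdeg : P.natDegree ≤ 1
        · rw [shiftPoly_of_natDegree_le_one hdeg (hS P hP).eval_zero] at huniq ⊢
          obtain ⟨y, hy, hy'⟩ := (hmB P hP).2 hdeg
          refine ⟨y, hy, fun Q hQ h => ?_⟩
          rw [huniq Q hQ h]
          exact hy'
        · obtain ⟨y, hy⟩ := (hVne P).preimage (T ^ (-c + intVal P m)).surjective
          refine ⟨y, fun Q hQ e he h => ?_, fun Q hQ h => ?_⟩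
          · exact absurd h.symm ((hmB P hP).1 (not_le.1 hdeg) Q hQ e he)
          · rw [huniq Q hQ h]
            exact hy
      · obtain ⟨y, hy⟩ := hW R
        exact ⟨y, hy, fun P hP h => absurd ⟨P, hP, h⟩ hex⟩

/-- Start the tail beyond every index used by the `k c`. -/
theorem exists_bound_of_mem_finiteSums {a : ℕ → ℤ} {F : Finset ℤ} {k : ℤ → ℤ}
    (hk : ∀ c ∈ F, k c ∈ finiteSums a) :
    ∃ M, ∀ n ∈ finiteSums fun i => a (i + M), ∀ c ∈ F, n + k c ∈ finiteSums a := by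
  classical
  choose! s hs hsk using hk
  refine ⟨(F.biUnion s).sup id + 1, fun n hn c hc => ?_⟩
  obtain ⟨t, ht, htM, rfl⟩ := finiteSums_comp_add_subset a _ hn
  rw [hsk c hc, ← Finset.sum_union]
  · exact sum_mem_finiteSums a (ht.mono Finset.subset_union_left)
  · rw [Finset.disjoint_left]
    intro i hi hi'
    have h1 : i ≤ (F.biUnion s).sup id :=
      Finset.le_sup (f := id) (Finset.mem_biUnion.2 ⟨c, hc, hi'⟩)
    have h2 := htM i hi
    omega

theorem jointlyTransitive_of_petStep {X : Type*} [TopologicalSpace X] [CompactSpace X]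
    {T : X ≃ₜ X} (hmin : IsMinimalSystem T) (hmix : IsTopMildlyMixing T) {S : Finset ℝ[X]}
    (hS : ∀ P ∈ S, IsNormalized P) {p : ℝ[X]} (hp : p ∈ S)
    (ih : ∀ F : Finset ℤ, F.Nonempty → ∀ k, JointlyTransitive T (petStep S p F k)) :
    JointlyTransitive T S := by
  intro a ha U hU hUne V hV hVne
  obtain ⟨F, hF⟩ := hmin.exists_finset_cover hU hUne
  have : Nonempty X := ⟨hUne.some⟩
  obtain ⟨c₀, hc₀, -⟩ := hF hUne.some
  obtain ⟨k, hk, hW⟩ := hmix.exists_targetSet_nonempty hS ha hV hVne F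
  obtain ⟨M, hM⟩ := exists_bound_of_mem_finiteSums hk
  have hWo := isOpen_targetSet T S F k hV
  obtain ⟨n, hn, x, hx, hxR⟩ := ih F ⟨c₀, hc₀⟩ k _ (ha.comp_add M)
    (targetSet T S F k V p) (hWo p) (hW p) (fun R => targetSet T S F k V (R + p))
    (fun R => hWo _) fun R => hW _
  -- This `c` is known only after `n` and `x`, so the targets had to cover all of `F`.
  obtain ⟨c, hc, hcU⟩ := hF ((T ^ (-intVal p n)) x)
  refine ⟨n + k c, hM n hn c hc, _, hcU, fun P hP => ?_⟩
  have key : (T ^ intVal (shiftPoly P (k c) - p) n) x ∈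
      targetSet T S F k V (shiftPoly P (k c)) := by
    -- The zero increment was erased from the family; its condition falls on `x` itself, already in
    -- the target of `p`.
    by_cases h0 : shiftPoly P (k c) - p = 0
    · rw [h0, sub_eq_zero.1 h0]
      simpa [intVal] using hx
    · have := hxR _ (mem_petStep.2 ⟨h0, P, hP, c, hc, rfl⟩)
      simpa only [sub_add_cancel] using this
  have := key P hP c hc rfl
  rw [← zpow_add_apply, intVal_shiftPoly_sub (hS P hP) (hS p hp)] at this
  rw [← zpow_add_apply, ← zpow_add_apply]
  convert this using 3
  ring

theorem jointlyTransitive {X : Type*} [TopologicalSpace X] [CompactSpace X]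
    {T : X ≃ₜ X} (hmin : IsMinimalSystem T) (hmix : IsTopMildlyMixing T) (S : Finset ℝ[X])
    (hS : ∀ P ∈ S, IsNormalized P) : JointlyTransitive T S := by
  induction S using petLT_wellFounded.induction with
  | _ S ih =>
    rcases S.eq_empty_or_nonempty with rfl | hne
    · intro a _ U _ hUne V _ _
      exact ⟨_, sum_mem_finiteSums a (Finset.singleton_nonempty 0), hUne.some, hUne.some_mem,
        by simp⟩
    · obtain ⟨p, hp, hpmin⟩ := S.exists_min_image natDegree hne
      exact jointlyTransitive_of_petStep hmin hmix hS hp fun F hF k =>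
        ih _ (petStep_lt hS hp hpmin hF k) (petStep_isNormalized hS hp F k)

/-! ### Return to the given polynomials, and Baire category -/

theorem exists_mem_forall_zpow_mem {X : Type*} [TopologicalSpace X] [CompactSpace X]
    {T : X ≃ₜ X} (hmin : IsMinimalSystem T) (hmix : IsTopMildlyMixing T) {ι : Type*} [Fintype ι]
    {p : ι → ℤ → ℤ} (hp : ∀ i, IsIntegralPolynomial (p i)) (hconst : ∀ i, ¬ IsConstantFun (p i))
    (hdiff : ∀ i j, i ≠ j → ¬ IsConstantFun (fun n => p i n - p j n))
    {A : Set ℤ} (hA : IsIPSet A) {U : Set X} (hU : IsOpen U) (hUne : U.Nonempty)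
    {V : ι → Set X} (hV : ∀ i, IsOpen (V i)) (hVne : ∀ i, (V i).Nonempty) :
    ∃ n ∈ A, ∃ x ∈ U, ∀ i, (T ^ p i n) x ∈ V i := by
  classical
  obtain ⟨b, hb, hbA⟩ := exists_zeroSumFree_subset hA
  choose P hP using hp
  let Q : ι → ℝ[X] := fun i => P i - C (p i 0 : ℝ)
  have hQ : ∀ i (n : ℤ), (Q i).eval (n : ℝ) = ((p i n - p i 0 : ℤ) : ℝ) := fun i n => by
    simp [Q, hP]
  have hQval : ∀ i n, intVal (Q i) n = p i n - p i 0 := fun i n => by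
    rw [intVal, hQ, Int.floor_intCast]
  have hinj : Function.Injective Q := by
    intro i j hij
    by_contra hne
    refine hdiff i j hne ⟨p i 0 - p j 0, fun n => ?_⟩
    have h1 := hQval i n
    rw [hij, hQval] at h1
    linarith
  have hnorm : ∀ R ∈ Finset.univ.image Q, IsNormalized R := by
    intro R hR
    obtain ⟨i, -, rfl⟩ := Finset.mem_image.1 hR
    refine ⟨fun n => ⟨_, hQ i n⟩, by simpa using hQ i 0, fun h0 => hconst i ⟨p i 0, fun n => ?_⟩⟩
    have := hQval i n
    simp only [h0, intVal, eval_zero, Int.floor_zero] at this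
    linarith
  -- The removed constants `p i 0` are absorbed into the targets; injectivity of `Q` leaves at most
  -- one condition on each.
  let W : ℝ[X] → Set X := fun R => {y | ∀ i, Q i = R → (T ^ p i 0) y ∈ V i}
  have hWo : ∀ R, IsOpen (W R) := fun R => by
    simp only [W, ofPred_forall]
    exact isOpen_iInter_of_finite fun i => isOpen_iInter_of_finite fun _ =>
      (hV i).preimage (T ^ p i 0).continuous
  have hWne : ∀ R, (W R).Nonempty := fun R => by
    by_cases hex : ∃ i, Q i = R
    · obtain ⟨i, rfl⟩ := hex
      obtain ⟨y, hy⟩ := (hVne i).preimage (T ^ p i 0).surjective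
      refine ⟨y, fun j hj => ?_⟩
      rw [hinj hj]
      exact hy
    · exact ⟨hUne.some, fun i h => absurd ⟨i, h⟩ hex⟩
  obtain ⟨n, hn, x, hx, h⟩ := jointlyTransitive hmin hmix _ hnorm b hb U hU hUne W hWo hWne
  refine ⟨n, hbA hn, x, hx, fun i => ?_⟩
  have := h (Q i) (Finset.mem_image_of_mem _ (Finset.mem_univ i)) i rfl
  rwa [← zpow_add_apply, hQval, add_sub_cancel] at this

theorem corollary1p4 {X : Type*} [MetricSpace X] [CompactSpace X] (T : X ≃ₜ X)
    (hmin : IsMinimalSystem T) (hmix : IsTopMildlyMixing T)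
    (d : ℕ) (hd : 1 ≤ d) (p : Fin d → ℤ → ℤ)
    (hp : ∀ i, IsIntegralPolynomial (p i))
    (hconst : ∀ i, ¬ IsConstantFun (p i))
    (hdiff : ∀ i j, i ≠ j → ¬ IsConstantFun (fun n => p i n - p j n))
    (A : Set ℤ) (hA : IsIPSet A) :
    ∃ X₀ : Set X, IsGδ X₀ ∧ Dense X₀ ∧
      ∀ x ∈ X₀, Dense {y : Fin d → X | ∃ n ∈ A, y = fun i => (T ^ (p i n)) x} := by
  let 𝓑 := TopologicalSpace.countableBasis X
  let I : Set (Fin d → Set X) := {V | ∀ i, V i ∈ 𝓑}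
  have hI : I.Countable :=
    countable_pi fun _ => TopologicalSpace.countable_countableBasis X
  let G : (Fin d → Set X) → Set X := fun V => {x | ∃ n ∈ A, ∀ i, (T ^ p i n) x ∈ V i}
  have hVo : ∀ V ∈ I, ∀ i, IsOpen (V i) := fun V hV i =>
    TopologicalSpace.isOpen_of_mem_countableBasis (hV i)
  have hGo : ∀ V ∈ I, IsOpen (G V) := fun V hV => by
    simp only [G, ← exists_prop, ofPred_exists, ofPred_forall]
    exact isOpen_iUnion fun n => isOpen_iUnion fun _ => isOpen_iInter_of_finite fun i =>
      (hVo V hV i).preimage (T ^ p i n).continuous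
  have hGd : ∀ V ∈ I, Dense (G V) := fun V hV => by
    refine dense_iff_inter_open.2 fun U hU hUne => ?_
    obtain ⟨n, hn, x, hx, h⟩ := exists_mem_forall_zpow_mem hmin hmix hp hconst hdiff hA hU hUne
      (hVo V hV) fun i => TopologicalSpace.nonempty_of_mem_countableBasis (hV i)
    exact ⟨x, hx, n, hn, h⟩
  refine ⟨⋂ V ∈ I, G V, IsGδ.biInter hI fun V hV => (hGo V hV).isGδ,
    dense_biInter_of_isOpen hGo hI hGd, fun x hx => ?_⟩
  refine dense_iff_inter_open.2 fun O hO ⟨y, hy⟩ => ?_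
  obtain ⟨u, hu, huO⟩ := isOpen_pi_iff'.1 hO y hy
  choose V hVB hyV hVu using fun i =>
    (TopologicalSpace.isBasis_countableBasis X).exists_subset_of_mem_open (hu i).2 (hu i).1
  obtain ⟨n, hn, h⟩ := mem_iInter₂.1 hx V hVB
  exact ⟨_, huO fun i _ => hVu i (h i), n, hn, rfl⟩
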